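/- Let $0<a\le 1$ and let $\zeta(s,a)$ be the Hurwitz zeta function, i.e. the analytic continuation of $\sum_{n\ge 0}(n+a)^{-s}$ ($\Re s>1$) to $\mathbb{C}\setminus\{1\}$, with a simple pole of residue $1$ at $s=1$. The function $(s-1)\zeta(s,a)$ is understood as an entire function of $s$, with value $1$ at $s=1$. Put $$\psi(t)=\frac{te^{t}}{(e^{t}-1)^2}-\frac{1}{e^{t}-1}+\frac{(a-1)t}{e^{t}-1},\qquad S_n(s,a)=\sum_{k=0}^{n-1}(-1)^k\binom{n-1}{k}(k+a)^{-s}\quad(n\ge 1).$$ For $0<\varepsilon<2\pi$ let $\mathcal{C}$ be the Hankel contour of radius $\varepsilon$: it runs from $-\infty$ to $-\varepsilon$ along the lower side of the negative real axis (where $\arg t=-\pi$), counterclockwise around the circle $|t|=\varepsilon$ (with $\arg t$ running from $-\pi$ to $\pi$), and from $-\varepsilon$ back to $-\infty$ along the upper side (where $\arg t=\pi$); on it $t^{s-1}=e^{(s-1)(\log|t|+i\arg t)}$. Then: (C) For every $s\in\mathbb{C}$ the integral $\int_{\mathcal{C}}\psi(-t)e^{(a-1)t}t^{s-1}\,dt$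 converges absolutely, and $$(s-1)\zeta(s,a)=\frac{\Gamma(1-s)}{2\pi i}\int_{\mathcal{C}}\psi(-t)e^{(a-1)t}t^{s-1}\,dt ;$$ at $s=1,2,3,\dots$, where $\Gamma(1-s)$ has a pole, the right-hand side is understood as its limit as $s$ tends to that point. (D) For every $s\in\mathbb{C}$ the following series converges absolutely, and $$(s-1)\zeta(s,a)=\sum_{n=1}^{\infty}S_n(s,a)\left(\frac{1}{n+1}+\frac{a-1}{n}\right).$$ -/

import Mathlib

open Complex Set Filter Topology MeasureTheory

noncomputable section

/-- The function `s ↦ (s - 1) ζ(s, a)`, with the removable singularity at `s = 1` filled in: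
the Hurwitz zeta function has a simple pole with residue `1` there. -/
def subOneMulHurwitz (a : ℝ) (s : ℂ) : ℂ :=
  if s = 1 then 1 else (s - 1) * HurwitzZeta.hurwitzZeta (a : UnitAddCircle) s

/-- For `Re s > 1` the Hurwitz zeta function is the series `∑ (n + a)⁻ˢ`, `n ≥ 0`. -/
theorem subOneMulHurwitz_of_one_lt_re {a : ℝ} (ha : 0 < a) (ha1 : a ≤ 1) {s : ℂ} (hs : 1 < s.re) :
    subOneMulHurwitz a s = (s - 1) * ∑' n : ℕ, 1 / ((n : ℂ) + a) ^ s := by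
  have h1 : s ≠ 1 := by
    rintro rfl
    simp at hs
  rw [subOneMulHurwitz, if_neg h1,
    (HurwitzZeta.hasSum_hurwitzZeta_of_one_lt_re ⟨ha.le, ha1⟩ hs).tsum_eq]

/-- The function `(s - 1) ζ(s, a)`, so completed at `s = 1`, is entire. -/
theorem differentiable_subOneMulHurwitz (a : ℝ) : Differentiable ℂ (subOneMulHurwitz a) := by
  have key : ∀ s : ℂ, s ≠ 1 → DifferentiableAt ℂ (subOneMulHurwitz a) s := by
    intro s hs
    have h : DifferentiableAt ℂ
        (fun z : ℂ => (z - 1) * HurwitzZeta.hurwitzZeta (a : UnitAddCircle) z) s :=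
      (differentiableAt_id.sub_const 1).mul (HurwitzZeta.differentiableAt_hurwitzZeta _ hs)
    refine h.congr_of_eventuallyEq ?_
    filter_upwards [isOpen_ne.mem_nhds hs] with z hz
    simp [subOneMulHurwitz, if_neg (show z ≠ 1 from hz)]
  have hc : ContinuousAt (subOneMulHurwitz a) 1 := by
    rw [continuousAt_iff_punctured_nhds]
    have h := HurwitzZeta.hurwitzZeta_residue_one (a : UnitAddCircle)
    have h1 : subOneMulHurwitz a 1 = 1 := if_pos rfl
    rw [h1]
    refine h.congr' ?_
    filter_upwards [self_mem_nhdsWithin] with z hz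
    simp [subOneMulHurwitz, if_neg (show z ≠ 1 from hz)]
  have hd := (differentiableOn_compl_singleton_and_continuousAt_iff
    (s := (univ : Set ℂ)) (c := 1) univ_mem).1
    ⟨fun z hz => (key z hz.2).differentiableWithinAt, hc⟩
  exact fun s => hd.differentiableAt univ_mem

/-- The alternating sum `S_n(s, a) = ∑_{k=0}^{n-1} (-1)^k (n-1 choose k) (k + a)^{-s}`, `n ≥ 1`. -/
def altSum (n : ℕ) (s : ℂ) (a : ℝ) : ℂ :=
  ∑ k ∈ Finset.range n, (-1) ^ k * ((n - 1).choose k : ℂ) * ((k : ℂ) + a) ^ (-s)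

/-- The function `ψ(t) = t e^t / (e^t - 1)^2 - 1 / (e^t - 1) + (a - 1) t / (e^t - 1)`, for complex
`t` outside `2πiℤ`. -/
def psiFun (a : ℝ) (t : ℂ) : ℂ :=
  t * exp t / (exp t - 1) ^ 2 - 1 / (exp t - 1) + ((a : ℂ) - 1) * t / (exp t - 1)

/-- The value of the integrand `g(t) t^{s-1}` at the point `t = r e^{iθ}`, with the branch
`arg t = θ` of the power. Along the Hankel contour, `θ` runs from `-π` to `π`. -/
def branchIntegrand (g : ℂ → ℂ) (s : ℂ) (r θ : ℝ) : ℂ :=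
  g (r * exp (θ * I)) * exp ((s - 1) * ((Real.log r : ℂ) + θ * I))

/-- Absolute convergence of `∫_C g(t) t^{s-1} dt` along each of the three parts of the Hankel
contour with radius `ε`. -/
def HankelIntegrable (g : ℂ → ℂ) (s : ℂ) (ε : ℝ) : Prop :=
  IntegrableOn (fun r : ℝ => branchIntegrand g s r (-Real.pi)) (Ioi ε) ∧
  IntervalIntegrable (fun θ : ℝ => branchIntegrand g s ε θ * (ε * exp (θ * I) * I)) volume
    (-Real.pi) Real.pi ∧
  IntegrableOn (fun r : ℝ => branchIntegrand g s r Real.pi) (Ioi ε)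

/-- The integral `∫_C g(t) t^{s-1} dt` along the Hankel contour: from `-∞` to `-ε` on the lower
side of the negative real axis (`t = r e^{-iπ}`, `dt = -dr`, `r` decreasing from `∞` to `ε`), then
counterclockwise along the circle `|t| = ε` (`t = ε e^{iθ}`), then from `-ε` back to `-∞` on the
upper side (`t = r e^{iπ}`, `dt = -dr`, `r` increasing from `ε` to `∞`). -/
def hankelIntegral (g : ℂ → ℂ) (s : ℂ) (ε : ℝ) : ℂ :=
  (∫ r in Ioi ε, branchIntegrand g s r (-Real.pi)) +
  (∫ θ in (-Real.pi)..Real.pi, branchIntegrand g s ε θ * (ε * exp (θ * I) * I)) -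
  (∫ r in Ioi ε, branchIntegrand g s r Real.pi)

/-- The expression `Γ(1-s) / (2πi) ∫_C ψ(-t) e^{(a-1)t} t^{s-1} dt`. -/
def hankelRepr (a : ℝ) (ε : ℝ) (s : ℂ) : ℂ :=
  Gamma (1 - s) / (2 * Real.pi * I) *
    hankelIntegral (fun t => psiFun a (-t) * exp (((a : ℂ) - 1) * t)) s ε

end

/-! Riemann's method covers both parts. Let `g` be holomorphic in a punctured disc about 0, `O(1/t)`
at 0, and exponentially decaying along the negative axis. Its Hankel integral is entire in `s` and
independent of the radius; for `Re s > 1` the circle shrinks to 0 and the two edges of the cut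
combine to `2i sin(πs)` times the Mellin transform of `g(-r)`. If that transform is `Γ(s) Z(s)` with
`Z` entire, the reflection formula and the identity theorem give `2πi Z(s) / Γ(1 - s)` for every `s`
(`hankelIntegral_eq_div_Gamma`).

For (C), the kernel `ψ(-t) e^{(a-1)t}` at `t = -r` is `-(r B(r))'` with `B(r) = ∑ e^{-(k+a)r}`, so
its Mellin transform is `Γ(s) (s-1) ζ(s,a)`.

For (D), put `z = 1 - e^t`. The logarithmic series `-t/z = ∑ zⁿ/(n+1)` expands the same kernel as `∑
cₙ e^{at} zⁿ`, where `cₙ = 1/(n+2) + (a-1)/(n+1)`, and the kernel `e^{at} zⁿ` has Mellin transform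
`Γ(s) S_{n+1}(s,a)`. The expansion holds on the whole Hankel contour of radius 1/4, and termwise
integration gives the series (`hasSum_hankelIntegral`). At `s = 1, 2, …`, where `1/Γ(1-s)` vanishes,
the Mellin transforms are compared directly. A `HasSum` in `ℂ` is unconditional, hence absolute,
convergence. -/

/-- Conditions under which the Hankel integral of `g` is an entire function of `s`, does not depend
on the radius `ε < R`, and is determined by the Mellin transform of `r ↦ g (-r)`. -/
structure HankelAdmissible (g : ℂ → ℂ) (R b : ℝ) : Prop where
  pos : 0 < b
  differentiableAt : ∀ t : ℂ, t ≠ 0 → ‖t‖ < R → DifferentiableAt ℂ g t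
  continuousOn : ContinuousOn (fun r : ℝ => g (-(r : ℂ))) (Ioi 0)
  decay : (fun r : ℝ => g (-(r : ℂ))) =O[atTop] fun r => Real.exp (-b * r)
  pole : g =O[𝓝[≠] 0] fun t => t⁻¹

/-! ### The integrand on the edges of the cut, and convergence along the contour -/

theorem branchIntegrand_pi (g : ℂ → ℂ) (s : ℂ) {r : ℝ} (hr : 0 < r) :
    branchIntegrand g s r Real.pi =
      exp (Real.pi * I * (s - 1)) * ((r : ℂ) ^ (s - 1) • g (-(r : ℂ))) := by
  have hr' : (r : ℂ) ≠ 0 := by exact_mod_cast hr.ne'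
  rw [branchIntegrand, exp_pi_mul_I, cpow_def_of_ne_zero hr', ← ofReal_log hr.le, smul_eq_mul,
    ← mul_assoc, ← exp_add, mul_comm]
  ring_nf

theorem branchIntegrand_neg_pi (g : ℂ → ℂ) (s : ℂ) {r : ℝ} (hr : 0 < r) :
    branchIntegrand g s r (-Real.pi) =
      exp (-(Real.pi * I * (s - 1))) * ((r : ℂ) ^ (s - 1) • g (-(r : ℂ))) := by
  have hr' : (r : ℂ) ≠ 0 := by exact_mod_cast hr.ne'
  have h : exp (((-Real.pi : ℝ) : ℂ) * I) = -1 := by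
    rw [ofReal_neg, neg_mul, exp_neg, exp_pi_mul_I]; norm_num
  rw [branchIntegrand, h, cpow_def_of_ne_zero hr', ← ofReal_log hr.le, smul_eq_mul,
    ← mul_assoc, ← exp_add, mul_comm]
  push_cast
  ring_nf

theorem circle_point_ne_zero {r : ℝ} (hr : 0 < r) (θ : ℝ) : (r : ℂ) * exp (θ * I) ≠ 0 :=
  mul_ne_zero (by exact_mod_cast hr.ne') (exp_ne_zero _)

theorem norm_circle_point {r : ℝ} (hr : 0 < r) (θ : ℝ) : ‖(r : ℂ) * exp (θ * I)‖ = r := by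
  rw [norm_mul, norm_exp_ofReal_mul_I, mul_one, norm_real, Real.norm_of_nonneg hr.le]

namespace HankelAdmissible

variable {g : ℂ → ℂ} {R b : ℝ}

theorem continuous_circle (h : HankelAdmissible g R b) {ε : ℝ} (hε : 0 < ε) (hεR : ε < R) :
    Continuous fun θ : ℝ => g (ε * exp (θ * I)) := by
  refine continuous_iff_continuousAt.2 fun θ => ?_
  have h1 := (h.differentiableAt _ (circle_point_ne_zero hε θ)
    (by rwa [norm_circle_point hε])).continuousAt
  exact ContinuousAt.comp (f := fun θ : ℝ => (ε : ℂ) * exp (θ * I)) h1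
    (by fun_prop)

theorem isBigO_zero (h : HankelAdmissible g R b) :
    (fun r : ℝ => g (-(r : ℂ))) =O[𝓝[>] 0] (fun r : ℝ => r ^ (-(1 : ℝ))) := by
  have h1 : Tendsto (fun r : ℝ => -(r : ℂ)) (𝓝[>] 0) (𝓝[≠] 0) := by
    refine tendsto_nhdsWithin_iff.2 ⟨?_, ?_⟩
    · refine Tendsto.mono_left ?_ nhdsWithin_le_nhds
      have : Continuous fun r : ℝ => -(r : ℂ) := by fun_prop
      simpa using this.tendsto 0
    · filter_upwards [self_mem_nhdsWithin] with r hr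
      simpa using (ne_of_gt hr : r ≠ 0)
  refine (h.pole.comp_tendsto h1).trans (Asymptotics.IsBigO.of_bound 1 ?_)
  filter_upwards [self_mem_nhdsWithin] with r hr
  simp [Real.rpow_neg_one]

theorem mellinConvergent (h : HankelAdmissible g R b) {s : ℂ} (hs : 1 < s.re) :
    MellinConvergent (fun r : ℝ => g (-(r : ℂ))) s :=
  mellinConvergent_of_isBigO_rpow_exp h.pos
    (h.continuousOn.locallyIntegrableOn measurableSet_Ioi) h.decay h.isBigO_zero hs

theorem indicator_locallyIntegrableOn (h : HankelAdmissible g R b) (ε : ℝ) :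
    LocallyIntegrableOn ((Ioi ε).indicator fun r : ℝ => g (-(r : ℂ))) (Ioi 0) := by
  intro x hx
  obtain ⟨u, hu, hi⟩ := h.continuousOn.locallyIntegrableOn measurableSet_Ioi (μ := volume) x hx
  exact ⟨u, hu, hi.indicator measurableSet_Ioi⟩

theorem indicator_decay (h : HankelAdmissible g R b) (ε : ℝ) :
    ((Ioi ε).indicator fun r : ℝ => g (-(r : ℂ))) =O[atTop] fun r => Real.exp (-b * r) :=
  (Asymptotics.isBigO_of_le _ fun _ => norm_indicator_le_norm_self _ _).trans h.decay

theorem indicator_isBigO_zero {ε : ℝ} (hε : 0 < ε) (c : ℝ) :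
    ((Ioi ε).indicator fun r : ℝ => g (-(r : ℂ))) =O[𝓝[>] 0] fun r : ℝ => r ^ c := by
  refine Asymptotics.IsBigO.of_bound 0 ?_
  filter_upwards [nhdsWithin_le_nhds (Iio_mem_nhds hε)] with r hr
  rw [indicator_of_notMem (by simpa using (le_of_lt hr : r ≤ ε))]
  simp

theorem mellinConvergent_indicator (h : HankelAdmissible g R b) {ε : ℝ} (hε : 0 < ε) (s : ℂ) :
    MellinConvergent ((Ioi ε).indicator fun r : ℝ => g (-(r : ℂ))) s :=
  mellinConvergent_of_isBigO_rpow_exp (b := s.re - 1) h.pos (h.indicator_locallyIntegrableOn ε)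
    (h.indicator_decay ε) (indicator_isBigO_zero hε _) (by linarith)

/-- The cut-off function vanishes near 0, so it is `O(r^c)` for every `c`, and no lower bound on `Re
s` is needed. This makes the ray integrals entire. -/
theorem differentiable_mellin_indicator (h : HankelAdmissible g R b) {ε : ℝ} (hε : 0 < ε) :
    Differentiable ℂ (mellin ((Ioi ε).indicator fun r : ℝ => g (-(r : ℂ)))) := fun s =>
  mellin_differentiableAt_of_isBigO_rpow_exp (b := s.re - 1) h.pos
    (h.indicator_locallyIntegrableOn ε) (h.indicator_decay ε) (indicator_isBigO_zero hε _)
    (by linarith)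

theorem indicator_smul (ε : ℝ) (s : ℂ) :
    (fun t : ℝ => (t : ℂ) ^ (s - 1) • (Ioi ε).indicator (fun r : ℝ => g (-(r : ℂ))) t) =
      (Ioi ε).indicator fun t : ℝ => (t : ℂ) ^ (s - 1) • g (-(t : ℂ)) := by
  ext t
  by_cases ht : t ∈ Ioi ε
  · simp only [indicator_of_mem ht]
  · simp only [indicator_of_notMem ht, smul_zero]

theorem integrableOn_ray (h : HankelAdmissible g R b) {ε : ℝ} (hε : 0 < ε) (s : ℂ) :
    IntegrableOn (fun r : ℝ => (r : ℂ) ^ (s - 1) • g (-(r : ℂ))) (Ioi ε) := by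
  have h1 := h.mellinConvergent_indicator hε s
  rw [MellinConvergent, indicator_smul, integrableOn_indicator_iff measurableSet_Ioi,
    inter_eq_left.2 (Ioi_subset_Ioi hε.le)] at h1
  exact h1

theorem mellin_indicator {ε : ℝ} (hε : 0 < ε) (s : ℂ) :
    mellin ((Ioi ε).indicator fun r : ℝ => g (-(r : ℂ))) s =
      ∫ r in Ioi ε, (r : ℂ) ^ (s - 1) • g (-(r : ℂ)) := by
  rw [mellin, indicator_smul, setIntegral_indicator measurableSet_Ioi,
    inter_eq_right.2 (Ioi_subset_Ioi hε.le)]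

theorem hankelIntegrable (h : HankelAdmissible g R b) {ε : ℝ} (hε : 0 < ε) (hεR : ε < R) (s : ℂ) :
    HankelIntegrable g s ε := by
  refine ⟨?_, ?_, ?_⟩
  · exact IntegrableOn.congr_fun ((h.integrableOn_ray hε s).const_mul _)
      (fun r hr => (branchIntegrand_neg_pi g s (hε.trans hr)).symm) measurableSet_Ioi
  · refine Continuous.intervalIntegrable ?_ _ _
    exact ((h.continuous_circle hε hεR).mul (by fun_prop)).mul (by fun_prop)
  · exact IntegrableOn.congr_fun ((h.integrableOn_ray hε s).const_mul _)
      (fun r hr => (branchIntegrand_pi g s (hε.trans hr)).symm) measurableSet_Ioi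

end HankelAdmissible

theorem setIntegral_branchIntegrand_pi (g : ℂ → ℂ) (s : ℂ) {ε : ℝ} (hε : 0 < ε) :
    ∫ r in Ioi ε, branchIntegrand g s r Real.pi =
      exp (Real.pi * I * (s - 1)) * ∫ r in Ioi ε, (r : ℂ) ^ (s - 1) • g (-(r : ℂ)) := by
  rw [← integral_const_mul]
  exact setIntegral_congr_fun measurableSet_Ioi fun r hr => branchIntegrand_pi g s (hε.trans hr)

theorem setIntegral_branchIntegrand_neg_pi (g : ℂ → ℂ) (s : ℂ) {ε : ℝ} (hε : 0 < ε) :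
    ∫ r in Ioi ε, branchIntegrand g s r (-Real.pi) =
      exp (-(Real.pi * I * (s - 1))) * ∫ r in Ioi ε, (r : ℂ) ^ (s - 1) • g (-(r : ℂ)) := by
  rw [← integral_const_mul]
  exact setIntegral_congr_fun measurableSet_Ioi fun r hr => branchIntegrand_neg_pi g s (hε.trans hr)

/-! ### Dependence on `s` and on the radius; evaluation by the Mellin transform -/

/-- The integral along the circle is entire in `s`. -/
theorem differentiable_circle_integral {k : ℝ → ℂ} (hk : Continuous k) (ℓ : ℝ) :
    Differentiable ℂ fun s : ℂ => ∫ θ in (-Real.pi)..Real.pi,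
      k θ * exp ((s - 1) * ((ℓ : ℂ) + θ * I)) := by
  intro s₀
  obtain ⟨C, hC⟩ := ((isCompact_closedBall s₀ 1).prod
    (isCompact_uIcc (a := -Real.pi) (b := Real.pi))).exists_bound_of_continuousOn
    (f := fun p : ℂ × ℝ => k p.2 * (exp ((p.1 - 1) * ((ℓ : ℂ) + p.2 * I)) * ((ℓ : ℂ) + p.2 * I)))
    (by fun_prop)
  refine (intervalIntegral.hasDerivAt_integral_of_dominated_loc_of_deriv_le
    (F' := fun s θ => k θ * (exp ((s - 1) * ((ℓ : ℂ) + θ * I)) * ((ℓ : ℂ) + θ * I)))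
    (bound := fun _ => C) (Metric.closedBall_mem_nhds s₀ one_pos) ?_ ?_ ?_ ?_ ?_ ?_).2.differentiableAt
  · exact Eventually.of_forall fun s => Continuous.aestronglyMeasurable (by fun_prop)
  · exact Continuous.intervalIntegrable (by fun_prop) _ _
  · exact Continuous.aestronglyMeasurable (by fun_prop)
  · exact Eventually.of_forall fun θ hθ s hs => hC (s, θ) ⟨hs, uIoc_subset_uIcc hθ⟩
  · exact intervalIntegrable_const
  · refine Eventually.of_forall fun θ _ s _ => ?_
    have h1 : HasDerivAt (fun s : ℂ => (s - 1) * ((ℓ : ℂ) + θ * I)) ((ℓ : ℂ) + θ * I) s := by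
      simpa using ((hasDerivAt_id s).sub_const 1).mul_const ((ℓ : ℂ) + θ * I)
    exact h1.cexp.const_mul (k θ)

namespace HankelAdmissible

variable {g : ℂ → ℂ} {R b : ℝ}

theorem differentiable_hankelIntegral (h : HankelAdmissible g R b) {ε : ℝ} (hε : 0 < ε)
    (hεR : ε < R) : Differentiable ℂ fun s => hankelIntegral g s ε := by
  have h1 := differentiable_circle_integral
    (k := fun θ => g (ε * exp (θ * I)) * (ε * exp (θ * I) * I))
    ((h.continuous_circle hε hεR).mul (by fun_prop)) (Real.log ε)
  have h2 := h.differentiable_mellin_indicator hε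
  have h3 : (fun s => hankelIntegral g s ε) = fun s =>
      exp (-(Real.pi * I * (s - 1))) * mellin ((Ioi ε).indicator fun r : ℝ => g (-(r : ℂ))) s +
      (∫ θ in (-Real.pi)..Real.pi, g (ε * exp (θ * I)) * (ε * exp (θ * I) * I) *
        exp ((s - 1) * ((Real.log ε : ℂ) + θ * I))) -
      exp (Real.pi * I * (s - 1)) * mellin ((Ioi ε).indicator fun r : ℝ => g (-(r : ℂ))) s := by
    ext s
    rw [hankelIntegral, setIntegral_branchIntegrand_pi g s hε,
      setIntegral_branchIntegrand_neg_pi g s hε, mellin_indicator hε]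
    congr 3
    ext θ
    rw [branchIntegrand]
    ring
  rw [h3]
  fun_prop

/-- Cauchy's theorem in the coordinate `w = log t`, on the rectangle between two radii. -/
theorem hankelIntegral_eq (h : HankelAdmissible g R b) {δ ε : ℝ} (hδ : 0 < δ) (hδε : δ ≤ ε)
    (hεR : ε < R) (s : ℂ) : hankelIntegral g s δ = hankelIntegral g s ε := by
  have hε : 0 < ε := hδ.trans_le hδε
  -- The last factor `exp w` comes from `dt = e^w dw`. The vertical sides of the rectangle map to
  -- the two circles, the horizontal ones to segments of the two edges of the cut.
  set f : ℂ → ℂ := fun w => g (exp w) * exp ((s - 1) * w) * exp w with hf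
  have hfb : ∀ r > 0, ∀ θ : ℝ, f ((Real.log r : ℝ) + θ * I) =
      branchIntegrand g s r θ * (r * exp (θ * I)) := by
    intro r hr θ
    have : exp (((Real.log r : ℝ) : ℂ) + θ * I) = r * exp (θ * I) := by
      rw [exp_add, ← ofReal_exp, Real.exp_log hr]
    simp only [hf, branchIntegrand, this]
  have hlog : Real.log δ ≤ Real.log ε := Real.log_le_log hδ hδε
  have hdiff : DifferentiableOn ℂ f
      (uIcc (Real.log δ) (Real.log ε) ×ℂ uIcc (-Real.pi) Real.pi) := by
    intro w hw
    rw [mem_reProdIm, uIcc_of_le hlog] at hw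
    have h1 : ‖exp w‖ < R := by
      rw [norm_exp]
      exact (((Real.le_log_iff_exp_le hε).1 hw.1.2)).trans_lt hεR
    have h2 : DifferentiableAt ℂ (fun w => g (exp w)) w :=
      (h.differentiableAt _ (exp_ne_zero _) h1).comp w (by fun_prop)
    exact ((h2.mul (by fun_prop)).mul (by fun_prop)).differentiableWithinAt
  have hrect := integral_boundary_rect_eq_zero_of_differentiableOn f
    ⟨Real.log δ, -Real.pi⟩ ⟨Real.log ε, Real.pi⟩ hdiff
  -- Substitution `r = e^x`; since `e^{iθ} = -1` on both edges, `dt = -dr`, which reverses the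
  -- difference of the two tails.
  have hray : ∀ θ : ℝ, exp (θ * I) = -1 →
      IntegrableOn (fun r => branchIntegrand g s r θ) (Ioi δ) →
      ∫ x : ℝ in (Real.log δ)..(Real.log ε), f (x + θ * I) =
        (∫ r in Ioi ε, branchIntegrand g s r θ) - ∫ r in Ioi δ, branchIntegrand g s r θ := by
    intro θ hθ hint
    have hpos : ∀ r ∈ Real.exp '' uIcc (Real.log δ) (Real.log ε), 0 < r := by
      rintro _ ⟨x, -, rfl⟩
      exact Real.exp_pos x
    have hcont : ContinuousOn (fun r => branchIntegrand g s r θ)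
        (Real.exp '' uIcc (Real.log δ) (Real.log ε)) := by
      have h1 : ContinuousOn (fun r : ℝ => g (r * exp (θ * I)))
          (Real.exp '' uIcc (Real.log δ) (Real.log ε)) := by
        simp only [hθ, mul_neg_one]
        exact h.continuousOn.mono hpos
      have h2 : ContinuousOn Real.log (Real.exp '' uIcc (Real.log δ) (Real.log ε)) :=
        Real.continuousOn_log.mono fun r hr => (hpos r hr).ne'
      exact h1.mul (by fun_prop)
    have h1 := intervalIntegral.integral_deriv_smul_comp'' (a := Real.log δ) (b := Real.log ε)
      (f := Real.exp) (f' := Real.exp) (g := fun r => branchIntegrand g s r θ) (by fun_prop)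
      (fun x _ => (Real.hasDerivAt_exp x).hasDerivWithinAt) (by fun_prop) hcont
    rw [Real.exp_log hδ, Real.exp_log hε, ← intervalIntegral.integral_Ioi_sub_Ioi hint hδε] at h1
    rw [← neg_sub, ← h1, ← intervalIntegral.integral_neg]
    refine intervalIntegral.integral_congr fun x _ => ?_
    have h2 := hfb (Real.exp x) (Real.exp_pos x) θ
    rw [Real.log_exp, hθ] at h2
    simp only [h2, Function.comp_apply, real_smul]
    ring
  have hcirc : ∀ r > 0, I • (∫ y : ℝ in (-Real.pi)..Real.pi, f ((Real.log r : ℝ) + y * I)) =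
      ∫ θ in (-Real.pi)..Real.pi, branchIntegrand g s r θ * (r * exp (θ * I) * I) := by
    intro r hr
    rw [← intervalIntegral.integral_smul]
    refine intervalIntegral.integral_congr fun y _ => ?_
    simp only [hfb r hr, smul_eq_mul]
    ring
  have hint := h.hankelIntegrable hδ (hδε.trans_lt hεR) s
  simp only [] at hrect
  rw [hray (-Real.pi) (by rw [ofReal_neg, neg_mul, exp_neg, exp_pi_mul_I]; norm_num) hint.1,
    hray Real.pi exp_pi_mul_I hint.2.2, hcirc δ hδ, hcirc ε hε] at hrect
  rw [hankelIntegral, hankelIntegral]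
  linear_combination -hrect

/-- On `|t| = δ` the kernel is at most `C/δ`, the power at most `δ^{Re s - 1} e^{π|Im s|}`, and the
length is `2πδ`; the product is of order `δ^{Re s - 1}`. -/
theorem tendsto_circle_integral (h : HankelAdmissible g R b) {s : ℂ} (hs : 1 < s.re) :
    Tendsto (fun δ : ℝ => ∫ θ in (-Real.pi)..Real.pi,
      branchIntegrand g s δ θ * (δ * exp (θ * I) * I)) (𝓝[>] 0) (𝓝 0) := by
  obtain ⟨C, hC⟩ := h.pole.bound
  obtain ⟨ρ, hρ, hball⟩ := Metric.mem_nhdsWithin_iff.1 hC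
  have hlim : Tendsto (fun δ : ℝ =>
      |C| * Real.exp (|s.im| * Real.pi) * δ ^ (s.re - 1) * |Real.pi - -Real.pi|) (𝓝[>] 0) (𝓝 0) := by
    have h1 : Tendsto (fun δ : ℝ => δ ^ (s.re - 1)) (𝓝[>] 0) (𝓝 0) := by
      have := (Real.continuousAt_rpow_const 0 (s.re - 1) (Or.inr (by linarith))).tendsto
      rw [Real.zero_rpow (by linarith)] at this
      exact this.mono_left nhdsWithin_le_nhds
    simpa using (h1.const_mul (|C| * Real.exp (|s.im| * Real.pi))).mul_const |Real.pi - -Real.pi|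
  refine squeeze_zero_norm' ?_ hlim
  filter_upwards [self_mem_nhdsWithin, nhdsWithin_le_nhds (Iio_mem_nhds hρ)] with δ hδ hδρ
  refine intervalIntegral.norm_integral_le_of_norm_le_const fun θ hθ => ?_
  have hδ : 0 < δ := hδ
  rw [uIoc_of_le (by linarith [Real.pi_pos])] at hθ
  have hz := norm_circle_point hδ θ
  have h1 : ‖g (δ * exp (θ * I))‖ ≤ |C| * δ⁻¹ := by
    have hmem : (δ : ℂ) * exp (θ * I) ∈ Metric.ball 0 ρ ∩ {0}ᶜ :=
      ⟨by rw [mem_ball_zero_iff, hz]; exact hδρ, circle_point_ne_zero hδ θ⟩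
    have := hball hmem
    simp only [mem_ofPred_eq, norm_inv, hz] at this
    exact this.trans (by gcongr; exact le_abs_self C)
  have h2 : ‖exp ((s - 1) * ((Real.log δ : ℂ) + θ * I))‖ ≤
      δ ^ (s.re - 1) * Real.exp (|s.im| * Real.pi) := by
    rw [norm_exp, Real.rpow_def_of_pos hδ, ← Real.exp_add]
    refine Real.exp_le_exp.2 ?_
    have h3 : -(s.im * θ) ≤ |s.im| * Real.pi := by
      refine (neg_le_abs _).trans ?_
      rw [abs_mul]
      gcongr
      exact abs_le.2 ⟨hθ.1.le, hθ.2⟩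
    simp
    linarith
  rw [branchIntegrand, norm_mul, norm_mul, norm_mul _ I, hz, norm_I, mul_one]
  calc _ ≤ |C| * δ⁻¹ * (δ ^ (s.re - 1) * Real.exp (|s.im| * Real.pi)) * δ := by gcongr
    _ = _ := by field_simp

/-- For `Re s > 1` the circle can be shrunk to the origin. -/
theorem hankelIntegral_eq_sin_mul_mellin (h : HankelAdmissible g R b) {ε : ℝ} (hε : 0 < ε)
    (hεR : ε < R) {s : ℂ} (hs : 1 < s.re) :
    hankelIntegral g s ε = 2 * I * sin (Real.pi * s) * mellin (fun r : ℝ => g (-(r : ℂ))) s := by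
  have hray : Tendsto (fun δ : ℝ => ∫ r in Ioi δ, (r : ℂ) ^ (s - 1) • g (-(r : ℂ))) (𝓝[>] 0)
      (𝓝 (mellin (fun r : ℝ => g (-(r : ℂ))) s)) := by
    have := (h.mellinConvergent hs).continuousWithinAt_Ici_primitive_Ioi
    exact this.tendsto.mono_left (nhdsWithin_mono _ Ioi_subset_Ici_self)
  have hlim := ((hray.const_mul (exp (-(Real.pi * I * (s - 1))))).add
    (h.tendsto_circle_integral hs)).sub (hray.const_mul (exp (Real.pi * I * (s - 1))))
  have hconst : (fun δ : ℝ => exp (-(Real.pi * I * (s - 1))) *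
        (∫ r in Ioi δ, (r : ℂ) ^ (s - 1) • g (-(r : ℂ))) +
      (∫ θ in (-Real.pi)..Real.pi, branchIntegrand g s δ θ * (δ * exp (θ * I) * I)) -
      exp (Real.pi * I * (s - 1)) * ∫ r in Ioi δ, (r : ℂ) ^ (s - 1) • g (-(r : ℂ)))
      =ᶠ[𝓝[>] 0] fun _ => hankelIntegral g s ε := by
    filter_upwards [self_mem_nhdsWithin, nhdsWithin_le_nhds (Iio_mem_nhds hε)] with δ hδ hδε
    rw [← setIntegral_branchIntegrand_pi g s hδ, ← setIntegral_branchIntegrand_neg_pi g s hδ]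
    exact h.hankelIntegral_eq hδ (le_of_lt hδε) hεR s
  -- The integral does not depend on `δ`, so it equals its limit as `δ → 0`.
  rw [tendsto_nhds_unique (tendsto_const_nhds.congr' hconst.symm) hlim]
  have h1 : exp (-(Real.pi * I * (s - 1))) = -exp (-(Real.pi * s) * I) := by
    rw [show -(Real.pi * I * (s - 1)) = -(Real.pi * s) * I + Real.pi * I by ring, exp_add,
      exp_pi_mul_I, mul_neg_one]
  have h2 : exp (Real.pi * I * (s - 1)) = -exp (Real.pi * s * I) := by
    rw [show Real.pi * I * (s - 1) = Real.pi * s * I - Real.pi * I by ring, exp_sub,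
      exp_pi_mul_I, div_neg, div_one]
  rw [h1, h2, Complex.sin]
  linear_combination (-(exp (-(Real.pi * s) * I) - exp (Real.pi * s * I)) *
    mellin (fun r : ℝ => g (-(r : ℂ))) s) * I_sq

/-- If `Z` is entire and the Mellin transform of `r ↦ g (-r)` is `Γ(s) Z(s)` for `Re s > 1`, then
the Hankel integral of `g` is `2πi Z(s) / Γ(1 - s)` for all `s`. -/
theorem hankelIntegral_eq_div_Gamma (h : HankelAdmissible g R b) {ε : ℝ} (hε : 0 < ε)
    (hεR : ε < R) {Z : ℂ → ℂ} (hZ : Differentiable ℂ Z)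
    (hM : ∀ s : ℂ, 1 < s.re → mellin (fun r : ℝ => g (-(r : ℂ))) s = Gamma s * Z s) (s : ℂ) :
    hankelIntegral g s ε = 2 * Real.pi * I * Z s * (Gamma (1 - s))⁻¹ := by
  have hd : Differentiable ℂ fun s : ℂ => 2 * Real.pi * I * Z s * (Gamma (1 - s))⁻¹ := by
    have : Differentiable ℂ fun s : ℂ => (Gamma (1 - s))⁻¹ :=
      differentiable_one_div_Gamma.comp (by fun_prop : Differentiable ℂ fun s : ℂ => 1 - s)
    fun_prop
  -- Both sides are entire, so equality near the point 2, inside `Re s > 1`, suffices.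
  have key := AnalyticOnNhd.eq_of_eventuallyEq (𝕜 := ℂ) (z₀ := 2)
    ((h.differentiable_hankelIntegral hε hεR).differentiableOn.analyticOnNhd isOpen_univ)
    (hd.differentiableOn.analyticOnNhd isOpen_univ) ?_
  · exact congrFun key s
  have hopen : {s : ℂ | 1 < s.re} ∈ 𝓝 (2 : ℂ) :=
    (isOpen_lt continuous_const continuous_re).mem_nhds (show (1 : ℝ) < (2 : ℂ).re by norm_num)
  filter_upwards [hopen] with s hs
  have hG : Gamma s ≠ 0 := Gamma_ne_zero_of_re_pos (by linarith)
  rw [h.hankelIntegral_eq_sin_mul_mellin hε hεR hs, hM s hs]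
  have hr := Gamma_mul_Gamma_one_sub s
  have hpi : (Real.pi : ℂ) ≠ 0 := by exact_mod_cast Real.pi_ne_zero
  -- When the sine vanishes, the reflection formula reads `Γ(s) Γ(1-s) = π/0 = 0` by the default
  -- value of division, so `Γ(1-s)` takes its default value 0 and both sides vanish.
  by_cases hsin : sin (Real.pi * s) = 0
  · rw [hsin, div_zero] at hr
    rw [hsin, (mul_eq_zero.1 hr).resolve_left hG]
    simp
  · have hG1 : Gamma (1 - s) ≠ 0 := by
      intro h0
      rw [h0, mul_zero] at hr
      exact div_ne_zero hpi hsin hr.symm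
    rw [eq_div_iff hsin] at hr
    field_simp
    linear_combination Z s * hr

end HankelAdmissible

/-! ### The kernels and the expansion in powers of `1 - e^t` -/

/-- The integrand `ψ(-t) e^{(a-1)t}` without its power factor. -/
noncomputable def psiKernel (a : ℝ) (t : ℂ) : ℂ := psiFun a (-t) * exp (((a : ℂ) - 1) * t)

/-- The kernel `e^{at} (1 - e^t)^n` of the alternating sums. -/
noncomputable def altKernel (a : ℝ) (n : ℕ) (t : ℂ) : ℂ := exp (a * t) * (1 - exp t) ^ n

/-- The coefficients of the expansion of `psiKernel` in powers of `1 - e^t`. -/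
noncomputable def altCoeff (a : ℝ) (n : ℕ) : ℂ :=
  1 / (((n + 1 : ℕ) : ℂ) + 1) + ((a : ℂ) - 1) / ((n + 1 : ℕ) : ℂ)

theorem norm_altCoeff_le {a : ℝ} (ha : 0 < a) (ha1 : a ≤ 1) (n : ℕ) :
    ‖altCoeff a n‖ ≤ 2 / ((n : ℝ) + 1) := by
  have h1 : ‖(1 : ℂ) / (((n + 1 : ℕ) : ℂ) + 1)‖ ≤ 1 / ((n : ℝ) + 1) := by
    rw [norm_div, norm_one, show (((n + 1 : ℕ) : ℂ) + 1) = ((n + 2 : ℕ) : ℂ) by push_cast; ring,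
      norm_natCast]
    push_cast
    gcongr
    norm_num
  have h2 : ‖((a : ℂ) - 1) / ((n + 1 : ℕ) : ℂ)‖ ≤ 1 / ((n : ℝ) + 1) := by
    rw [norm_div, norm_natCast, show (a : ℂ) - 1 = ((a - 1 : ℝ) : ℂ) by push_cast; ring,
      norm_real, Real.norm_eq_abs]
    push_cast
    gcongr
    rw [abs_le]
    constructor <;> linarith
  calc _ ≤ _ := norm_add_le _ _
    _ ≤ 1 / ((n : ℝ) + 1) + 1 / ((n : ℝ) + 1) := add_le_add h1 h2
    _ = _ := by ring

/-- This is the Taylor series of `-log(1 - z)` at `z = 1 - e^t`, divided by `z`. The bound on `Im t`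
makes the principal logarithm of `e^t` equal to `t`. -/
theorem hasSum_pow_div_succ {t : ℂ} (ht : t ≠ 0) (him : |t.im| < Real.pi) (hz : ‖1 - exp t‖ < 1) :
    1 - exp t ≠ 0 ∧ HasSum (fun n : ℕ => (1 - exp t) ^ n / ((n : ℂ) + 1)) (-t / (1 - exp t)) := by
  have him' := abs_lt.1 him
  have hlog : log (exp t) = t := log_exp him'.1 him'.2.le
  have hz0 : 1 - exp t ≠ 0 := by
    intro h
    rw [← sub_eq_zero.1 h, log_one] at hlog
    exact ht hlog.symm
  refine ⟨hz0, ?_⟩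
  have h1 := hasSum_taylorSeries_neg_log hz
  rw [sub_sub_cancel, hlog, ← hasSum_nat_add_iff' 1] at h1
  have h2 := h1.div_const (1 - exp t)
  simp only [Finset.range_one, Finset.sum_singleton, Nat.cast_zero, div_zero, sub_zero] at h2
  convert! h2 using 1
  funext n
  push_cast
  rw [pow_succ]
  field_simp

/-- With `z = 1 - e^t` the kernel is `e^{at} ((-t/z - 1)/z + (a-1)(-t/z))`. Removing the constant
term of the series for `-t/z` and dividing by `z` again produces the coefficients `1/(n+2)`. -/
theorem hasSum_altKernel (a : ℝ) {t : ℂ} (ht : t ≠ 0) (him : |t.im| < Real.pi)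
    (hz : ‖1 - exp t‖ < 1) :
    HasSum (fun n : ℕ => altCoeff a n * altKernel a n t) (psiKernel a t) := by
  obtain ⟨hz0, h1⟩ := hasSum_pow_div_succ ht him hz
  have h2 := ((hasSum_nat_add_iff' 1).2 h1).div_const (1 - exp t)
  have h3 := (h2.add (h1.mul_left ((a : ℂ) - 1))).mul_left (exp (a * t))
  have hE : exp t ≠ 0 := exp_ne_zero t
  have hval : psiKernel a t = exp (a * t) * ((-t / (1 - exp t) -
      ∑ i ∈ Finset.range 1, (1 - exp t) ^ i / ((i : ℂ) + 1)) / (1 - exp t) +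
      ((a : ℂ) - 1) * (-t / (1 - exp t))) := by
    have h6 : exp (((a : ℂ) - 1) * t) = exp (a * t) / exp t := by
      rw [← exp_sub]; ring_nf
    have h7 : exp (-t) - 1 = (1 - exp t) / exp t := by
      rw [exp_neg]; field_simp
    rw [psiKernel, psiFun, h6, h7, exp_neg]
    simp only [Finset.range_one, Finset.sum_singleton, pow_zero, Nat.cast_zero]
    field_simp
    ring
  rw [hval]
  convert! h3 using 1
  funext n
  have h4 : (n : ℂ) + 1 ≠ 0 := by exact_mod_cast Nat.succ_ne_zero n
  have h5 : (n : ℂ) + 1 + 1 ≠ 0 := by exact_mod_cast Nat.succ_ne_zero (n + 1)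
  rw [altCoeff, altKernel]
  push_cast
  rw [pow_succ]
  field_simp

theorem norm_one_sub_exp_neg {r : ℝ} (hr : 0 < r) :
    ‖1 - exp (-(r : ℂ))‖ = 1 - Real.exp (-r) := by
  have h : Real.exp (-r) < 1 := Real.exp_lt_one_iff.2 (by linarith)
  rw [← ofReal_neg, ← ofReal_exp, ← ofReal_one, ← ofReal_sub, norm_real,
    Real.norm_of_nonneg (by linarith)]

theorem norm_one_sub_exp_neg_lt {r : ℝ} (hr : 0 < r) : ‖1 - exp (-(r : ℂ))‖ < 1 := by
  rw [norm_one_sub_exp_neg hr]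
  linarith [Real.exp_pos (-r)]

theorem hasSum_altKernel_neg (a : ℝ) {r : ℝ} (hr : 0 < r) :
    HasSum (fun n : ℕ => altCoeff a n * altKernel a n (-(r : ℂ))) (psiKernel a (-(r : ℂ))) :=
  hasSum_altKernel a (by simpa using hr.ne') (by simpa using Real.pi_pos)
    (norm_one_sub_exp_neg_lt hr)

theorem norm_altKernel_neg (a : ℝ) (n : ℕ) {r : ℝ} (hr : 0 < r) :
    ‖altKernel a n (-(r : ℂ))‖ = Real.exp (-(a * r)) * (1 - Real.exp (-r)) ^ n := by
  rw [altKernel, norm_mul, norm_pow, norm_one_sub_exp_neg hr, norm_exp]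
  simp

/-- The same logarithmic series at `t = -r`, where all terms are positive, sums the termwise bounds
`2/(n+1)` in closed form. -/
theorem hasSum_real_majorant (a : ℝ) {r : ℝ} (hr : 0 < r) :
    HasSum (fun n : ℕ => 2 / ((n : ℝ) + 1) * (Real.exp (-(a * r)) * (1 - Real.exp (-r)) ^ n))
      (2 * Real.exp (-(a * r)) * (r / (1 - Real.exp (-r)))) := by
  have h := (hasSum_pow_div_succ (t := -(r : ℂ)) (by simpa using hr.ne')
    (by simpa using Real.pi_pos) (norm_one_sub_exp_neg_lt hr)).2
  have h' : HasSum (fun n : ℕ => (1 - Real.exp (-r)) ^ n / ((n : ℝ) + 1))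
      (r / (1 - Real.exp (-r))) := by
    rw [← Complex.hasSum_ofReal]
    push_cast
    simpa using h
  convert! (h'.mul_left (2 * Real.exp (-(a * r)))) using 1
  funext n
  ring

theorem div_one_sub_exp_neg_le {r : ℝ} (hr : 0 < r) : r / (1 - Real.exp (-r)) ≤ 1 + r := by
  have h : Real.exp (-r) < 1 := Real.exp_lt_one_iff.2 (by linarith)
  rw [div_le_iff₀ (by linarith)]
  have h1 : (1 + r) * Real.exp (-r) ≤ Real.exp r * Real.exp (-r) := by
    gcongr
    linarith [Real.add_one_le_exp r]
  rw [← Real.exp_add, add_neg_cancel, Real.exp_zero] at h1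
  linarith

theorem majorant_le (a : ℝ) {r : ℝ} (hr : 0 < r) :
    2 * Real.exp (-(a * r)) * (r / (1 - Real.exp (-r))) ≤ 2 * Real.exp (-(a * r)) * (1 + r) :=
  mul_le_mul_of_nonneg_left (div_one_sub_exp_neg_le hr) (by positivity)

theorem norm_altCoeff_mul_altKernel_le {a : ℝ} (ha : 0 < a) (ha1 : a ≤ 1) (n : ℕ) {r : ℝ}
    (hr : 0 < r) : ‖altCoeff a n * altKernel a n (-(r : ℂ))‖ ≤
      2 / ((n : ℝ) + 1) * (Real.exp (-(a * r)) * (1 - Real.exp (-r)) ^ n) := by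
  rw [norm_mul, norm_altKernel_neg a n hr]
  have h : Real.exp (-r) < 1 := Real.exp_lt_one_iff.2 (by linarith)
  have h' : 0 ≤ 1 - Real.exp (-r) := by linarith
  gcongr
  exact norm_altCoeff_le ha ha1 n

theorem norm_psiKernel_neg_le {a : ℝ} (ha : 0 < a) (ha1 : a ≤ 1) {r : ℝ} (hr : 0 < r) :
    ‖psiKernel a (-(r : ℂ))‖ ≤ 2 * Real.exp (-(a * r)) * (1 + r) := by
  refine le_trans ?_ (majorant_le a hr)
  exact (hasSum_altKernel_neg a hr).norm_le_of_bounded (hasSum_real_majorant a hr)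
    fun n => norm_altCoeff_mul_altKernel_le ha ha1 n hr

theorem majorant_isBigO {a : ℝ} (ha : 0 < a) :
    (fun r : ℝ => 2 * Real.exp (-(a * r)) * (1 + r)) =O[atTop]
      fun r => Real.exp (-(a / 2) * r) := by
  refine Asymptotics.IsBigO.of_bound (2 * (1 + 2 / a)) ?_
  filter_upwards [eventually_ge_atTop 0] with r hr
  rw [Real.norm_of_nonneg (by positivity), Real.norm_of_nonneg (by positivity),
    show -(a * r) = -(a / 2) * r + -(a / 2 * r) by ring, Real.exp_add]
  have h1 : 1 + r ≤ (1 + 2 / a) * Real.exp (a / 2 * r) := by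
    have h2 := Real.add_one_le_exp (a / 2 * r)
    have h3 : r = 2 / a * (a / 2 * r) := by field_simp
    have h4 : 0 ≤ a / 2 * r := by positivity
    have h5 : 2 / a * (a / 2 * r) ≤ 2 / a * Real.exp (a / 2 * r) := by gcongr; linarith
    nlinarith
  calc _ ≤ 2 * (Real.exp (-(a / 2) * r) * Real.exp (-(a / 2 * r))) *
        ((1 + 2 / a) * Real.exp (a / 2 * r)) := by gcongr
    _ = 2 * (1 + 2 / a) * Real.exp (-(a / 2) * r) *
        (Real.exp (-(a / 2 * r)) * Real.exp (a / 2 * r)) := by ring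
    _ = _ := by rw [← Real.exp_add, neg_add_cancel, Real.exp_zero, mul_one]

theorem psiKernel_decay {a : ℝ} (ha : 0 < a) (ha1 : a ≤ 1) :
    (fun r : ℝ => psiKernel a (-(r : ℂ))) =O[atTop] fun r => Real.exp (-(a / 2) * r) := by
  refine Asymptotics.IsBigO.trans (Asymptotics.IsBigO.of_bound 1 ?_) (majorant_isBigO ha)
  filter_upwards [eventually_gt_atTop 0] with r hr
  rw [one_mul]
  exact (norm_psiKernel_neg_le ha ha1 hr).trans (le_abs_self _)

/-- The two simple poles in `ψ` cancel at 0. The majorant already shows this: `2 · 1 · (1 + r) ≤ 4`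
for `r < 1`. Boundedness extends the Mellin transform to `Re s > 0`. -/
theorem psiKernel_isBigO_zero {a : ℝ} (ha : 0 < a) (ha1 : a ≤ 1) :
    (fun r : ℝ => psiKernel a (-(r : ℂ))) =O[𝓝[>] 0] fun r : ℝ => r ^ (-(0 : ℝ)) := by
  refine Asymptotics.IsBigO.of_bound 4 ?_
  filter_upwards [self_mem_nhdsWithin, nhdsWithin_le_nhds (Iio_mem_nhds one_pos)] with r hr hr1
  have hr : 0 < r := hr
  have hr1 : r < 1 := hr1
  have h1 : Real.exp (-(a * r)) ≤ 1 := Real.exp_le_one_iff.2 (by nlinarith)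
  have := norm_psiKernel_neg_le ha ha1 hr
  simp only [neg_zero, Real.rpow_zero, norm_one, mul_one]
  nlinarith [Real.exp_pos (-(a * r))]

/-! ### Admissibility of the kernels -/

theorem exp_neg_sub_one_ne_zero {t : ℂ} (ht : t ≠ 0) (hR : ‖t‖ < 2 * Real.pi) :
    exp (-t) - 1 ≠ 0 := by
  intro h
  obtain ⟨n, hn⟩ := exp_eq_one_iff.1 (sub_eq_zero.1 h)
  have h1 : ‖t‖ = |(n : ℝ)| * (2 * Real.pi) := by
    rw [← norm_neg, hn]
    simp [abs_of_pos Real.pi_pos]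
  have hn0 : n ≠ 0 := by
    rintro rfl
    simp at hn
    exact ht hn
  have h2 : (1 : ℝ) ≤ |(n : ℝ)| := by exact_mod_cast Int.one_le_abs hn0
  nlinarith [Real.pi_pos]

theorem differentiableAt_psiKernel (a : ℝ) {t : ℂ} (h : exp (-t) - 1 ≠ 0) :
    DifferentiableAt ℂ (psiKernel a) t := by
  unfold psiKernel psiFun
  have h2 : (exp (-t) - 1) ^ 2 ≠ 0 := pow_ne_zero 2 h
  fun_prop (disch := assumption)

/-- With `q = u/(e^u - 1) → 1`, one has `ψ(u) = u⁻¹ (q² e^u - q + (a-1) u q)`, and the bracket has a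
limit at 0. -/
theorem psiKernel_pole (a : ℝ) : psiKernel a =O[𝓝[≠] 0] fun t => t⁻¹ := by
  have hq : Tendsto (fun u : ℂ => u / (exp u - 1)) (𝓝[≠] 0) (𝓝 1) := by
    have h := (hasDerivAt_exp 0).tendsto_slope
    rw [exp_zero] at h
    simpa [slope_def_field] using h.inv₀ one_ne_zero
  have hneg : Tendsto (fun t : ℂ => -t) (𝓝[≠] 0) (𝓝[≠] 0) := by
    refine tendsto_nhdsWithin_iff.2 ⟨?_, ?_⟩
    · simpa using (continuous_neg.tendsto (0 : ℂ)).mono_left nhdsWithin_le_nhds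
    · filter_upwards [self_mem_nhdsWithin] with t ht
      simpa using ht
  have hid : Tendsto (fun u : ℂ => u) (𝓝[≠] 0) (𝓝 0) := nhdsWithin_le_nhds
  have hexp : Tendsto exp (𝓝[≠] 0) (𝓝 (exp 0)) :=
    (continuous_exp.tendsto 0).mono_left nhdsWithin_le_nhds
  have hexp2 : Tendsto (fun t => exp (((a : ℂ) - 1) * t)) (𝓝[≠] 0) (𝓝 (exp (((a : ℂ) - 1) * 0))) :=
    ((by fun_prop : Continuous fun t => exp (((a : ℂ) - 1) * t)).tendsto 0).mono_left
      nhdsWithin_le_nhds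
  have h1 := ((((hq.pow 2).mul hexp).sub hq).add ((hid.mul hq).const_mul ((a : ℂ) - 1))).comp hneg
  have h2 := (h1.neg.mul hexp2).isBigO_one ℂ
  have h3 := (Asymptotics.isBigO_refl (fun t : ℂ => t⁻¹) (𝓝[≠] 0)).mul h2
  refine (h3.congr' ?_ ?_)
  · filter_upwards [self_mem_nhdsWithin] with t ht
    have ht : t ≠ 0 := ht
    simp only [Function.comp_apply, psiKernel, psiFun]
    -- If the denominators vanish, division by zero makes both sides 0, so no nonvanishing near 0
    -- has to be proved.
    by_cases hE : exp (-t) - 1 = 0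
    · simp [hE]
    · field_simp
      ring
  · exact Eventually.of_forall fun t => mul_one _

theorem hankelAdmissible_psiKernel {a : ℝ} (ha : 0 < a) (ha1 : a ≤ 1) :
    HankelAdmissible (psiKernel a) (2 * Real.pi) (a / 2) where
  pos := by positivity
  differentiableAt t ht hR := differentiableAt_psiKernel a (exp_neg_sub_one_ne_zero ht hR)
  continuousOn := by
    intro r hr
    have hr : 0 < r := hr
    have h1 : exp (-(-(r : ℂ))) - 1 ≠ 0 := by
      rw [neg_neg, ← ofReal_exp, sub_ne_zero]
      exact_mod_cast (Real.one_lt_exp_iff.2 hr).ne'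
    exact (ContinuousAt.comp (f := fun r : ℝ => -(r : ℂ))
      (differentiableAt_psiKernel a h1).continuousAt (by fun_prop)).continuousWithinAt
  decay := psiKernel_decay ha ha1
  pole := psiKernel_pole a

theorem isBigO_inv_of_continuous {g : ℂ → ℂ} (hg : Continuous g) : g =O[𝓝[≠] 0] fun t => t⁻¹ := by
  have h1 : Tendsto (fun t => t * g t) (𝓝[≠] 0) (𝓝 (0 * g 0)) :=
    ((by fun_prop : Continuous fun t => t * g t).tendsto 0).mono_left nhdsWithin_le_nhds
  have h3 := (Asymptotics.isBigO_refl (fun t : ℂ => t⁻¹) (𝓝[≠] 0)).mul (h1.isBigO_one ℂ)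
  refine h3.congr' ?_ (Eventually.of_forall fun t => mul_one _)
  filter_upwards [self_mem_nhdsWithin] with t ht
  exact inv_mul_cancel_left₀ ht _

theorem hankelAdmissible_of_differentiable {g : ℂ → ℂ} (hg : Differentiable ℂ g) {b : ℝ}
    (hb : 0 < b)
    (hdecay : (fun r : ℝ => g (-(r : ℂ))) =O[atTop] fun r => Real.exp (-b * r)) (R : ℝ) :
    HankelAdmissible g R b where
  pos := hb
  differentiableAt t _ _ := hg t
  continuousOn := (hg.continuous.comp (by fun_prop)).continuousOn
  decay := hdecay
  pole := isBigO_inv_of_continuous hg.continuous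

theorem differentiable_altKernel (a : ℝ) (n : ℕ) : Differentiable ℂ (altKernel a n) := by
  unfold altKernel
  fun_prop

theorem hankelAdmissible_altKernel {a : ℝ} (ha : 0 < a) (n : ℕ) (R : ℝ) :
    HankelAdmissible (altKernel a n) R a := by
  refine hankelAdmissible_of_differentiable (differentiable_altKernel a n) ha ?_ R
  refine Asymptotics.IsBigO.of_bound 1 ?_
  filter_upwards [eventually_gt_atTop 0] with r hr
  have h : Real.exp (-r) < 1 := Real.exp_lt_one_iff.2 (by linarith)
  rw [norm_altKernel_neg a n hr, Real.norm_of_nonneg (Real.exp_pos _).le, one_mul, neg_mul]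
  exact mul_le_of_le_one_right (Real.exp_pos _).le
    (pow_le_one₀ (by linarith) (by linarith [Real.exp_pos (-r)]))

/-! ### Mellin transforms of the kernels -/

/-- The binomial theorem writes the kernel as a combination of `e^{-(k+a)r}`, each with Mellin
transform `Γ(s) (k+a)^{-s}`. The exponent `n` of the kernel is the `n - 1` of the alternating sum.
-/
theorem mellin_altKernel {a : ℝ} (ha : 0 < a) (n : ℕ) {s : ℂ} (hs : 0 < s.re) :
    mellin (fun r : ℝ => altKernel a n (-(r : ℂ))) s = Gamma s * altSum (n + 1) s a := by
  have hzero : ∀ i ∉ Finset.range (n + 1), n.choose i = 0 := fun i hi =>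
    Nat.choose_eq_zero_of_lt (by simpa using hi)
  have h := hasSum_mellin (a := fun i : ℕ => (-1) ^ i * (n.choose i : ℂ))
    (p := fun i : ℕ => (i : ℝ) + a) (F := fun r : ℝ => altKernel a n (-(r : ℂ))) (s := s)
    (fun i => Or.inr (by positivity)) hs ?_ ?_
  · rw [← h.tsum_eq, tsum_eq_sum (s := Finset.range (n + 1)) fun i hi => by simp [hzero i hi],
      altSum, Finset.mul_sum]
    refine Finset.sum_congr rfl fun i _ => ?_
    rw [cpow_neg]
    push_cast
    ring
  · intro t _
    have h1 : altKernel a n (-(t : ℂ)) = ∑ i ∈ Finset.range (n + 1),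
        (-1) ^ i * (n.choose i : ℂ) * Real.exp (-((i : ℝ) + a) * t) := by
      rw [altKernel, show 1 - exp (-(t : ℂ)) = -exp (-(t : ℂ)) + 1 by ring, add_pow,
        Finset.mul_sum]
      refine Finset.sum_congr rfl fun i _ => ?_
      rw [neg_pow, ← exp_nat_mul, one_pow, mul_one]
      push_cast
      rw [show -((i : ℂ) + a) * t = a * -t + i * -t by ring, exp_add]
      ring
    simp only [h1]
    exact hasSum_sum_of_ne_finset_zero fun i hi => by simp [hzero i hi]
  · exact summable_of_ne_finset_zero (s := Finset.range (n + 1)) fun i hi => by simp [hzero i hi]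

theorem differentiable_altSum {a : ℝ} (ha : 0 < a) (n : ℕ) :
    Differentiable ℂ fun s => altSum n s a := by
  unfold altSum
  refine Differentiable.fun_sum fun k _ => ?_
  have h : (k : ℂ) + a ≠ 0 := by exact_mod_cast (by positivity : (k : ℝ) + a ≠ 0)
  exact ((differentiable_id.neg).const_cpow (Or.inl h)).const_mul _

theorem hasSum_exp_neg (a : ℝ) {r : ℝ} (hr : 0 < r) :
    HasSum (fun k : ℕ => (1 : ℂ) * Real.exp (-((k : ℝ) + a) * r))
      (exp (-(a * r)) / (1 - exp (-(r : ℂ)))) := by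
  have hq : ‖exp (-(r : ℂ))‖ < 1 := by
    rw [norm_exp]; simpa using hr
  convert! (hasSum_geometric_of_norm_lt_one hq).mul_left (exp (-(a * r))) using 1
  funext k
  rw [← exp_nat_mul, ← exp_add]
  push_cast
  ring_nf

theorem hasSum_mul_exp_neg (a : ℝ) {r : ℝ} (hr : 0 < r) :
    HasSum (fun k : ℕ => ((k : ℂ) + a) * Real.exp (-((k : ℝ) + a) * r))
      (exp (-(a * r)) * (exp (-(r : ℂ)) / (1 - exp (-(r : ℂ))) ^ 2 + a / (1 - exp (-(r : ℂ))))) := by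
  have hq : ‖exp (-(r : ℂ))‖ < 1 := by
    rw [norm_exp]; simpa using hr
  convert! ((hasSum_coe_mul_geometric_of_norm_lt_one hq).add
    ((hasSum_geometric_of_norm_lt_one hq).mul_left (a : ℂ))).mul_left (exp (-(a * r))) using 1
  funext k
  rw [← exp_nat_mul, ← add_mul, mul_left_comm, ← exp_add]
  push_cast
  ring_nf

theorem mellinConvergent_exp_div {a : ℝ} (ha : 0 < a) {s : ℂ} (hs : 1 < s.re) :
    MellinConvergent (fun r : ℝ => exp (-(a * r)) / (1 - exp (-(r : ℂ)))) s := by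
  have hnorm : ∀ r : ℝ, 0 < r → ‖exp (-(a * r)) / (1 - exp (-(r : ℂ)))‖ ≤
      1 / 2 * (2 * Real.exp (-(a * r)) * (1 + r)) * r⁻¹ := by
    intro r hr
    have h := majorant_le a hr
    rw [norm_div, norm_one_sub_exp_neg hr, norm_exp]
    calc _ = 1 / 2 * (2 * Real.exp (-(a * r)) * (r / (1 - Real.exp (-r)))) * r⁻¹ := by
          simp; field_simp
      _ ≤ _ := by gcongr
  refine mellinConvergent_of_isBigO_rpow_exp (a := a / 2) (b := 1) (by positivity) ?_ ?_ ?_ hs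
  · refine ContinuousOn.locallyIntegrableOn (fun r hr => ?_) measurableSet_Ioi
    have hr : 0 < r := hr
    have h0 : 1 - exp (-(r : ℂ)) ≠ 0 := by
      rw [← ofReal_neg, ← ofReal_exp, sub_ne_zero]
      exact_mod_cast (Real.exp_lt_one_iff.2 (neg_lt_zero.2 hr)).ne'
    exact ContinuousAt.continuousWithinAt (by fun_prop (disch := assumption))
  · refine Asymptotics.IsBigO.trans (Asymptotics.IsBigO.of_bound 1 ?_) (majorant_isBigO ha)
    filter_upwards [eventually_ge_atTop 1] with r hr
    have hr0 : 0 < r := by linarith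
    have h1 : r⁻¹ ≤ 1 := inv_le_one_of_one_le₀ hr
    rw [one_mul, Real.norm_of_nonneg (by positivity)]
    refine (hnorm r hr0).trans ?_
    have h2 : 0 ≤ 2 * Real.exp (-(a * r)) * (1 + r) := by positivity
    nlinarith
  · refine Asymptotics.IsBigO.of_bound 2 ?_
    filter_upwards [self_mem_nhdsWithin, nhdsWithin_le_nhds (Iio_mem_nhds one_pos)] with r hr hr1
    have hr : 0 < r := hr
    have hr1 : r < 1 := hr1
    have h1 : Real.exp (-(a * r)) ≤ 1 := Real.exp_le_one_iff.2 (by nlinarith)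
    refine (hnorm r hr).trans ?_
    rw [Real.rpow_neg_one, Real.norm_of_nonneg (by positivity)]
    gcongr
    nlinarith [Real.exp_pos (-(a * r))]

/-- This is `r A - B` with `B = ∑ e^{-(k+a)r}` and `A = -B' = ∑ (k+a) e^{-(k+a)r}`. The factor `r`
is written as a complex power so that it shifts the Mellin variable by one. -/
theorem psiKernel_neg_eq (a : ℝ) {r : ℝ} (hr : 0 < r) :
    psiKernel a (-(r : ℂ)) =
      (r : ℂ) ^ (1 : ℂ) • (exp (-(a * r)) *
        (exp (-(r : ℂ)) / (1 - exp (-(r : ℂ))) ^ 2 + a / (1 - exp (-(r : ℂ))))) -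
      exp (-(a * r)) / (1 - exp (-(r : ℂ))) := by
  have h0 : 1 - exp (-(r : ℂ)) ≠ 0 := by
    rw [← ofReal_neg, ← ofReal_exp, sub_ne_zero]
    exact_mod_cast (Real.exp_lt_one_iff.2 (neg_lt_zero.2 hr)).ne'
  have hE : exp (-(r : ℂ)) ≠ 0 := exp_ne_zero _
  have h1 : exp (r : ℂ) = (exp (-(r : ℂ)))⁻¹ := by rw [exp_neg, inv_inv]
  have h2 : exp (((a : ℂ) - 1) * -r) = exp (-(a * r)) * (exp (-(r : ℂ)))⁻¹ := by
    rw [← h1, ← exp_add]; ring_nf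
  have h3 : (exp (-(r : ℂ)))⁻¹ - 1 = (1 - exp (-(r : ℂ))) / exp (-(r : ℂ)) := by field_simp
  rw [psiKernel, psiFun, neg_neg, h2, h1, h3, cpow_one, smul_eq_mul]
  field_simp
  ring

/-- The Mellin transform of `r ↦ psiKernel a (-r)` for `Re s > 1`. -/
theorem mellin_psiKernel_of_one_lt_re {a : ℝ} (ha : 0 < a) (ha1 : a ≤ 1) {s : ℂ}
    (hs : 1 < s.re) :
    mellin (fun r : ℝ => psiKernel a (-(r : ℂ))) s = Gamma s * subOneMulHurwitz a s := by
  have hs0 : 0 < s.re := by linarith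
  set A : ℝ → ℂ := fun r => exp (-(a * r)) *
    (exp (-(r : ℂ)) / (1 - exp (-(r : ℂ))) ^ 2 + a / (1 - exp (-(r : ℂ)))) with hA
  set B : ℝ → ℂ := fun r => exp (-(a * r)) / (1 - exp (-(r : ℂ))) with hB
  have hsum : Summable fun k : ℕ => 1 / ((k : ℝ) + a) ^ s.re := by
    refine ((Real.summable_one_div_nat_add_rpow a s.re).2 hs).congr fun k => ?_
    rw [abs_of_pos (by positivity)]
  have hpos : ∀ k : ℕ, (k : ℂ) + a ≠ 0 := fun k => by
    exact_mod_cast (by positivity : (k : ℝ) + a ≠ 0)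
  have hMB : HasSum (fun k : ℕ => Gamma s * 1 / (((k : ℝ) + a : ℝ) : ℂ) ^ s) (mellin B s) :=
    hasSum_mellin (a := fun _ => 1) (p := fun k : ℕ => (k : ℝ) + a)
      (fun k => Or.inr (by positivity)) hs0 (fun r hr => hasSum_exp_neg a hr)
      (by simpa using hsum)
  have hMA : HasSum (fun k : ℕ => Gamma (s + 1) * ((k : ℂ) + a) /
      (((k : ℝ) + a : ℝ) : ℂ) ^ (s + 1)) (mellin A (s + 1)) := by
    refine hasSum_mellin (a := fun k : ℕ => (k : ℂ) + a) (p := fun k : ℕ => (k : ℝ) + a)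
      (fun k => Or.inr (by positivity)) (by simp; linarith)
      (fun r hr => hasSum_mul_exp_neg a hr) (hsum.congr fun k => ?_)
    have h1 : (0 : ℝ) < (k : ℝ) + a := by positivity
    rw [show (k : ℂ) + a = (((k : ℝ) + a : ℝ) : ℂ) by push_cast; rfl, norm_real,
      Real.norm_of_nonneg h1.le, add_re, one_re, Real.rpow_add h1, Real.rpow_one]
    field_simp
  have hcongr : EqOn (fun r : ℝ => psiKernel a (-(r : ℂ)))
      (fun r => (r : ℂ) ^ (1 : ℂ) • A r - B r) (Ioi 0) := fun r hr => psiKernel_neg_eq a hr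
  have hBc : MellinConvergent B s := mellinConvergent_exp_div ha hs
  have hKc := (hankelAdmissible_psiKernel ha ha1).mellinConvergent hs
  -- Adding `B` back to the kernel uses only the convergence of those two transforms, not that of
  -- `A` at `s + 1`.
  have hrA : EqOn (fun r : ℝ => psiKernel a (-(r : ℂ)) + B r)
      (fun r => (r : ℂ) ^ (1 : ℂ) • A r) (Ioi 0) := fun r hr => by
    simp only [hcongr hr, sub_add_cancel]
  have hmel : mellin (fun r : ℝ => psiKernel a (-(r : ℂ))) s = mellin A (s + 1) - mellin B s := by
    rw [← mellin_cpow_smul, eq_sub_iff_add_eq, ← (hasMellin_add hKc hBc).2]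
    refine setIntegral_congr_fun measurableSet_Ioi fun r hr => ?_
    simp only [hrA hr]
  rw [hmel, subOneMulHurwitz_of_one_lt_re ha ha1 hs, ← (hMA.sub hMB).tsum_eq, ← tsum_mul_left,
    ← tsum_mul_left]
  -- Termwise, `Γ(s+1)(k+a)/(k+a)^{s+1} - Γ(s)/(k+a)^s = (s-1) Γ(s)/(k+a)^s`.
  refine tsum_congr fun k => ?_
  have hs' : s ≠ 0 := by
    rintro rfl
    simp at hs0
  have hk := hpos k
  have hks : ((k : ℂ) + a) ^ s ≠ 0 := by simp [cpow_eq_zero_iff, hk]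
  push_cast
  rw [Gamma_add_one s hs', cpow_add _ _ hk, cpow_one]
  field_simp

/-- Analytic continuation from `Re s > 1`; the gain is the point `s = 1`, which the series (D)
needs. -/
theorem mellin_psiKernel {a : ℝ} (ha : 0 < a) (ha1 : a ≤ 1) {s : ℂ} (hs : 0 < s.re) :
    mellin (fun r : ℝ => psiKernel a (-(r : ℂ))) s = Gamma s * subOneMulHurwitz a s := by
  have hopen : IsOpen {s : ℂ | 0 < s.re} := isOpen_lt continuous_const continuous_re
  have h1 : DifferentiableOn ℂ (mellin fun r : ℝ => psiKernel a (-(r : ℂ))) {s : ℂ | 0 < s.re} :=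
    fun z hz => (mellin_differentiableAt_of_isBigO_rpow_exp (a := a / 2) (by positivity)
      ((hankelAdmissible_psiKernel ha ha1).continuousOn.locallyIntegrableOn measurableSet_Ioi)
      (psiKernel_decay ha ha1) (psiKernel_isBigO_zero ha ha1) hz).differentiableWithinAt
  have h2 : DifferentiableOn ℂ (fun s => Gamma s * subOneMulHurwitz a s) {s : ℂ | 0 < s.re} := by
    intro z hz
    have hG : DifferentiableAt ℂ Gamma z := differentiableAt_Gamma z fun m hm => by
      have hz : 0 < z.re := hz
      rw [hm] at hz
      simp at hz
      linarith [(Nat.cast_nonneg m : (0 : ℝ) ≤ m)]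
    exact (hG.mul (differentiable_subOneMulHurwitz a z)).differentiableWithinAt
  refine (h1.analyticOnNhd hopen).eqOn_of_preconnected_of_eventuallyEq (h2.analyticOnNhd hopen)
    (convex_halfSpace_re_gt 0).isPreconnected (z₀ := 2) (by simp) ?_ hs
  filter_upwards [(isOpen_lt continuous_const continuous_re).mem_nhds
    (show (1 : ℝ) < (2 : ℂ).re by norm_num)] with z hz
  exact mellin_psiKernel_of_one_lt_re ha ha1 hz

/-! ### Termwise integration along the contour -/

/-- Termwise integration of the expansion of `psiKernel` along a part of the ray. -/
theorem hasSum_ray {a : ℝ} (ha : 0 < a) (ha1 : a ≤ 1) (s : ℂ) {S : Set ℝ} (hS : MeasurableSet S)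
    (hS0 : S ⊆ Ioi 0)
    (hint : IntegrableOn (fun r : ℝ => r ^ (s.re - 1) * (2 * Real.exp (-(a * r)) * (1 + r))) S) :
    HasSum (fun n : ℕ => altCoeff a n * ∫ r in S, (r : ℂ) ^ (s - 1) • altKernel a n (-(r : ℂ)))
      (∫ r in S, (r : ℂ) ^ (s - 1) • psiKernel a (-(r : ℂ))) := by
  simp_rw [← integral_const_mul]
  have hcpow : ContinuousOn (fun r : ℝ => (r : ℂ) ^ (s - 1)) S := fun r hr =>
    (continuousAt_ofReal_cpow_const r (s - 1) (Or.inr (ne_of_gt (hS0 hr)))).continuousWithinAt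
  have hnorm : ∀ r ∈ S, ‖(r : ℂ) ^ (s - 1)‖ = r ^ (s.re - 1) := fun r hr => by
    rw [norm_cpow_eq_rpow_re_of_pos (hS0 hr)]
    simp
  have hmaj : ∀ r ∈ S, HasSum (fun n : ℕ => r ^ (s.re - 1) *
      (2 / ((n : ℝ) + 1) * (Real.exp (-(a * r)) * (1 - Real.exp (-r)) ^ n)))
      (r ^ (s.re - 1) * (2 * Real.exp (-(a * r)) * (r / (1 - Real.exp (-r))))) :=
    fun r hr => (hasSum_real_majorant a (hS0 hr)).mul_left _
  refine hasSum_integral_of_dominated_convergence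
    (fun n r => r ^ (s.re - 1) *
      (2 / ((n : ℝ) + 1) * (Real.exp (-(a * r)) * (1 - Real.exp (-r)) ^ n))) ?_ ?_ ?_ ?_ ?_
  · intro n
    have h1 : Continuous fun r : ℝ => altKernel a n (-(r : ℂ)) :=
      (differentiable_altKernel a n).continuous.comp (by fun_prop)
    exact (continuousOn_const.mul (hcpow.smul h1.continuousOn)).aestronglyMeasurable hS
  · refine fun n => (ae_restrict_iff' hS).2 (Eventually.of_forall fun r hr => ?_)
    have hr0 : 0 < r := hS0 hr
    rw [smul_eq_mul, mul_left_comm, norm_mul, hnorm r hr]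
    gcongr
    exact norm_altCoeff_mul_altKernel_le ha ha1 n hr0
  · exact (ae_restrict_iff' hS).2 (Eventually.of_forall fun r hr => (hmaj r hr).summable)
  -- The sum of the dominating functions is known in closed form, and `r/(1 - e^{-r}) ≤ 1 + r`
  -- reduces its integrability to `hint`.
  · have h1 : IntegrableOn (fun r : ℝ => r ^ (s.re - 1) *
        (2 * Real.exp (-(a * r)) * (r / (1 - Real.exp (-r))))) S := by
      refine Integrable.mono' hint ?_ ((ae_restrict_iff' hS).2 (Eventually.of_forall fun r hr => ?_))
      · refine ContinuousOn.aestronglyMeasurable (fun r hr => ?_) hS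
        have hr0 : 0 < r := hS0 hr
        have h0 : 1 - Real.exp (-r) ≠ 0 :=
          (sub_pos.2 (Real.exp_lt_one_iff.2 (neg_lt_zero.2 hr0))).ne'
        have h2 := Real.continuousAt_rpow_const r (s.re - 1) (Or.inl hr0.ne')
        exact (h2.mul (by fun_prop (disch := assumption))).continuousWithinAt
      · have hr0 : 0 < r := hS0 hr
        have h0 : 0 < 1 - Real.exp (-r) := sub_pos.2 (Real.exp_lt_one_iff.2 (neg_lt_zero.2 hr0))
        rw [Real.norm_of_nonneg (by positivity)]
        exact mul_le_mul_of_nonneg_left (majorant_le a hr0) (by positivity)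
    exact h1.congr_fun (fun r hr => (hmaj r hr).tsum_eq.symm) hS
  · refine (ae_restrict_iff' hS).2 (Eventually.of_forall fun r hr => ?_)
    convert! (hasSum_altKernel_neg a (hS0 hr)).mul_left ((r : ℂ) ^ (s - 1)) using 1
    funext n
    rw [smul_eq_mul]
    ring

/-- An entire function whose values on the negative axis bound `psiKernel` there. -/
theorem hankelAdmissible_majorant {a : ℝ} (ha : 0 < a) (R : ℝ) :
    HankelAdmissible (fun t => 2 * exp (a * t) * (1 - t)) R (a / 2) := by
  refine hankelAdmissible_of_differentiable (by fun_prop) (by positivity) ?_ R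
  refine Asymptotics.IsBigO.trans (Asymptotics.IsBigO.of_bound 1 ?_) (majorant_isBigO ha)
  refine Eventually.of_forall fun r => le_of_eq ?_
  rw [one_mul, ← norm_real]
  push_cast
  ring_nf

theorem integrableOn_majorant {a : ℝ} {s : ℂ} {S : Set ℝ} (hS : MeasurableSet S) (hS0 : S ⊆ Ioi 0)
    (h : IntegrableOn (fun r : ℝ => (r : ℂ) ^ (s - 1) •
      (2 * exp (a * -(r : ℂ)) * (1 - -(r : ℂ)))) S) :
    IntegrableOn (fun r : ℝ => r ^ (s.re - 1) * (2 * Real.exp (-(a * r)) * (1 + r))) S := by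
  refine IntegrableOn.congr_fun h.norm (fun r hr => ?_) hS
  have hr0 : 0 < r := hS0 hr
  have h1 : (2 * exp (a * -(r : ℂ)) * (1 - -(r : ℂ))) =
      ((2 * Real.exp (-(a * r)) * (1 + r) : ℝ) : ℂ) := by
    push_cast
    ring_nf
  simp only [h1, norm_smul, norm_cpow_eq_rpow_re_of_pos hr0, norm_real]
  rw [Real.norm_of_nonneg (by positivity)]
  simp

theorem hasSum_mellin_altKernel {a : ℝ} (ha : 0 < a) (ha1 : a ≤ 1) {s : ℂ} (hs : 0 < s.re) :
    HasSum (fun n : ℕ => altCoeff a n * mellin (fun r : ℝ => altKernel a n (-(r : ℂ))) s)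
      (mellin (fun r : ℝ => psiKernel a (-(r : ℂ))) s) := by
  refine hasSum_ray ha ha1 s measurableSet_Ioi le_rfl
    (integrableOn_majorant measurableSet_Ioi le_rfl ?_)
  have hadm := hankelAdmissible_majorant ha 1
  refine mellinConvergent_of_isBigO_rpow_exp (b := 0) hadm.pos
    (hadm.continuousOn.locallyIntegrableOn measurableSet_Ioi) hadm.decay ?_ hs
  have h1 : Continuous fun r : ℝ => 2 * exp (a * -(r : ℂ)) * (1 - -(r : ℂ)) := by fun_prop
  simpa using ((h1.tendsto 0).mono_left nhdsWithin_le_nhds).isBigO_one ℝ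

/-- Radius 1/4 is small enough that `|e^t - 1| ≤ 2|t| = 1/2`, which gives a geometric majorant. -/
theorem norm_altKernel_circle_le {a : ℝ} (ha : 0 < a) (ha1 : a ≤ 1) (n : ℕ) {t : ℂ}
    (ht : ‖t‖ = 1 / 4) : ‖altCoeff a n * altKernel a n t‖ ≤ 2 * Real.exp 1 * (1 / 2) ^ n := by
  have h1 : ‖1 - exp t‖ ≤ 1 / 2 := by
    rw [norm_sub_rev]
    refine (norm_exp_sub_one_le (by rw [ht]; norm_num)).trans ?_
    rw [ht]; norm_num
  have h2 : ‖altCoeff a n‖ ≤ 2 := (norm_altCoeff_le ha ha1 n).trans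
    (div_le_self (by norm_num) (by linarith [(Nat.cast_nonneg n : (0 : ℝ) ≤ n)]))
  have h3 : ‖exp (a * t)‖ ≤ Real.exp 1 := by
    refine (norm_exp_le_exp_norm _).trans (Real.exp_le_exp.2 ?_)
    rw [norm_mul, norm_real, Real.norm_of_nonneg ha.le, ht]
    linarith
  rw [altKernel, norm_mul, norm_mul, norm_pow, ← mul_assoc]
  gcongr

/-- The expansion is valid on the whole contour: `0 < 1 - e^t < 1` on the rays, and `|1 - e^t| ≤
1/2` with `|Im t| < π` on the small circle. Dominated convergence applies to each part. -/
theorem hasSum_hankelIntegral {a : ℝ} (ha : 0 < a) (ha1 : a ≤ 1) (s : ℂ) :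
    HasSum (fun n : ℕ => altCoeff a n * hankelIntegral (altKernel a n) s (1 / 4))
      (hankelIntegral (psiKernel a) s (1 / 4)) := by
  have hε : (0 : ℝ) < 1 / 4 := by norm_num
  have hS0 : Ioi (1 / 4 : ℝ) ⊆ Ioi 0 := Ioi_subset_Ioi hε.le
  have hray := hasSum_ray ha ha1 s measurableSet_Ioi hS0 (integrableOn_majorant measurableSet_Ioi
    hS0 ((hankelAdmissible_majorant ha 1).integrableOn_ray hε s))
  set w : ℝ → ℂ := fun θ => exp ((s - 1) * ((Real.log (1 / 4) : ℂ) + θ * I)) *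
    ((1 / 4 : ℝ) * exp (θ * I) * I) with hw
  have hwc : Continuous w := by fun_prop
  have hgeom : ∀ θ, HasSum (fun n : ℕ => 2 * Real.exp 1 * (1 / 2) ^ n * ‖w θ‖)
      (2 * Real.exp 1 * 2 * ‖w θ‖) := fun θ =>
    (hasSum_geometric_two.mul_left _).mul_right _
  have hcirc : HasSum (fun n : ℕ => altCoeff a n * ∫ θ in (-Real.pi)..Real.pi,
      branchIntegrand (altKernel a n) s (1 / 4) θ * ((1 / 4 : ℝ) * exp (θ * I) * I))
      (∫ θ in (-Real.pi)..Real.pi,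
        branchIntegrand (psiKernel a) s (1 / 4) θ * ((1 / 4 : ℝ) * exp (θ * I) * I)) := by
    simp_rw [← intervalIntegral.integral_const_mul]
    refine intervalIntegral.hasSum_integral_of_dominated_convergence
      (fun n θ => 2 * Real.exp 1 * (1 / 2) ^ n * ‖w θ‖) ?_ ?_ ?_ ?_ ?_
    · intro n
      have h1 := (hankelAdmissible_altKernel ha n 1).continuous_circle hε (by norm_num)
      exact (continuous_const.mul ((h1.mul (by fun_prop)).mul
        (by fun_prop))).aestronglyMeasurable
    · refine fun n => Eventually.of_forall fun θ _ => ?_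
      rw [branchIntegrand, mul_assoc, ← mul_assoc, norm_mul]
      exact mul_le_mul_of_nonneg_right
        (norm_altKernel_circle_le ha ha1 n (norm_circle_point hε θ)) (norm_nonneg _)
    · exact Eventually.of_forall fun θ _ => (hgeom θ).summable
    · simp_rw [fun θ => (hgeom θ).tsum_eq]
      exact Continuous.intervalIntegrable (by fun_prop) _ _
    · refine Eventually.of_forall fun θ _ => ?_
      have hz := norm_circle_point hε θ
      have h1 : ‖1 - exp (((1 / 4 : ℝ) : ℂ) * exp (θ * I))‖ < 1 := by
        rw [norm_sub_rev]
        refine (norm_exp_sub_one_le (by rw [hz]; norm_num)).trans_lt ?_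
        rw [hz]; norm_num
      have h2 := hasSum_altKernel a (circle_point_ne_zero hε θ)
        ((abs_im_le_norm _).trans_lt (by rw [hz]; linarith [Real.pi_gt_three])) h1
      convert! h2.mul_right (w θ) using 1
      · funext n
        rw [branchIntegrand, hw]
        ring
      · rw [branchIntegrand, hw]
        ring
  have h := ((hray.mul_left (exp (-(Real.pi * I * (s - 1))))).add hcirc).sub
    (hray.mul_left (exp (Real.pi * I * (s - 1))))
  convert! h using 1
  · funext n
    rw [hankelIntegral, setIntegral_branchIntegrand_pi _ s hε,
      setIntegral_branchIntegrand_neg_pi _ s hε]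
    ring
  · rw [hankelIntegral, setIntegral_branchIntegrand_pi _ s hε,
      setIntegral_branchIntegrand_neg_pi _ s hε]

/-! ### The contour representation and the series -/

theorem Gamma_one_sub_ne_zero {s : ℂ} (hs : ∀ m : ℕ, s ≠ (m : ℂ) + 1) : Gamma (1 - s) ≠ 0 :=
  Gamma_ne_zero fun m hm => hs m (by linear_combination -hm)

theorem two_pi_I_mul_ne_zero : (2 * Real.pi * I : ℂ) ≠ 0 := by
  simp [Real.pi_ne_zero]

theorem hankelRepr_eq {a : ℝ} (ha : 0 < a) (ha1 : a ≤ 1) {ε : ℝ} (hε : 0 < ε)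
    (hε2 : ε < 2 * Real.pi) {s : ℂ} (hs : ∀ m : ℕ, s ≠ (m : ℂ) + 1) :
    hankelRepr a ε s = subOneMulHurwitz a s := by
  have h := (hankelAdmissible_psiKernel ha ha1).hankelIntegral_eq_div_Gamma hε hε2
    (differentiable_subOneMulHurwitz a)
    (fun z hz => mellin_psiKernel ha ha1 (zero_lt_one.trans hz)) s
  have hG := Gamma_one_sub_ne_zero hs
  have hpi := two_pi_I_mul_ne_zero
  change Gamma (1 - s) / (2 * Real.pi * I) * hankelIntegral (psiKernel a) s ε = _
  rw [h]
  field_simp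

theorem tendsto_hankelRepr {a : ℝ} (ha : 0 < a) (ha1 : a ≤ 1) {ε : ℝ} (hε : 0 < ε)
    (hε2 : ε < 2 * Real.pi) (m : ℕ) :
    Tendsto (hankelRepr a ε) (𝓝[≠] ((m : ℂ) + 1)) (𝓝 (subOneMulHurwitz a ((m : ℂ) + 1))) := by
  have hc := ((differentiable_subOneMulHurwitz a).continuous.tendsto ((m : ℂ) + 1)).mono_left
    (nhdsWithin_le_nhds (s := {(m : ℂ) + 1}ᶜ))
  refine hc.congr' ?_
  -- The unit ball about `m + 1` contains no other positive integer, so the equality off the poles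
  -- applies throughout the punctured ball.
  filter_upwards [self_mem_nhdsWithin,
    nhdsWithin_le_nhds (Metric.ball_mem_nhds ((m : ℂ) + 1) one_pos)] with z hz hz1
  refine (hankelRepr_eq ha ha1 hε hε2 fun k hk => hz ?_).symm
  rw [hk, Metric.mem_ball, dist_add_right, Complex.dist_eq] at hz1
  have h1 : |(k : ℤ) - (m : ℤ)| < 1 := by
    rw [← ofReal_natCast, ← ofReal_natCast, ← ofReal_sub, norm_real, Real.norm_eq_abs] at hz1
    exact_mod_cast hz1
  have h2 : k = m := by
    rw [Int.abs_lt_one_iff] at h1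
    omega
  rw [hk, h2]
  rfl

theorem hasSum_altSum {a : ℝ} (ha : 0 < a) (ha1 : a ≤ 1) (s : ℂ) :
    HasSum (fun n : ℕ => altSum (n + 1) s a * altCoeff a n) (subOneMulHurwitz a s) := by
  by_cases hs : ∀ m : ℕ, s ≠ (m : ℂ) + 1
  · have hε : (0 : ℝ) < 1 / 4 := by norm_num
    have hε2 : (1 / 4 : ℝ) < 2 * Real.pi := by linarith [Real.pi_gt_three]
    have hG := Gamma_one_sub_ne_zero hs
    have hpi := two_pi_I_mul_ne_zero
    rw [← hankelRepr_eq ha ha1 hε hε2 hs]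
    convert! (hasSum_hankelIntegral ha ha1 s).mul_left (Gamma (1 - s) / (2 * Real.pi * I)) using 1
    funext n
    rw [(hankelAdmissible_altKernel ha n (2 * Real.pi)).hankelIntegral_eq_div_Gamma hε hε2
      (differentiable_altSum ha (n + 1))
      (fun z hz => mellin_altKernel ha n (zero_lt_one.trans hz)) s]
    field_simp
  -- Here `1/Γ(1-s) = 0` and the Hankel identities are void. Since `Re s > 0`, the Mellin transforms
  -- converge and the nonzero factor `Γ(s)` can be cancelled.
  · push Not at hs
    obtain ⟨m, rfl⟩ := hs
    have hre : 0 < ((m : ℂ) + 1).re := by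
      simp
      positivity
    have h := hasSum_mellin_altKernel ha ha1 hre
    rw [mellin_psiKernel ha ha1 hre] at h
    have hG : Gamma ((m : ℂ) + 1) ≠ 0 := Gamma_ne_zero_of_re_pos hre
    convert! h.mul_left (Gamma ((m : ℂ) + 1))⁻¹ using 1
    · funext n
      rw [mellin_altKernel ha n hre]
      field_simp
    · field_simp

theorem corollary1 (a : ℝ) (ha : 0 < a) (ha1 : a ≤ 1) :
    -- (C): the contour integral converges for every `s`; the representation is an equality when
    -- `s` is not a pole of `Γ(1 - s)`, and holds as a limit when `s` is one of these poles
    (∀ ε : ℝ, 0 < ε → ε < 2 * Real.pi →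
      (∀ s : ℂ,
        HankelIntegrable (fun t => psiFun a (-t) * Complex.exp (((a : ℂ) - 1) * t)) s ε) ∧
      (∀ s : ℂ, (∀ m : ℕ, s ≠ (m : ℂ) + 1) → subOneMulHurwitz a s = hankelRepr a ε s) ∧
      (∀ m : ℕ, Tendsto (hankelRepr a ε) (𝓝[≠] ((m : ℂ) + 1))
        (𝓝 (subOneMulHurwitz a ((m : ℂ) + 1))))) ∧
    -- (D): the series over `n + 1 = 1, 2, 3, …`
    (∀ s : ℂ, HasSum
      (fun n : ℕ => altSum (n + 1) s a *
        (1 / (((n + 1 : ℕ) : ℂ) + 1) + ((a : ℂ) - 1) / ((n + 1 : ℕ) : ℂ)))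
      (subOneMulHurwitz a s)) :=
  ⟨fun _ hε hε2 =>
    ⟨fun s => (hankelAdmissible_psiKernel ha ha1).hankelIntegrable hε hε2 s,
      fun _ hs => (hankelRepr_eq ha ha1 hε hε2 hs).symm,
      fun m => tendsto_hankelRepr ha ha1 hε hε2 m⟩,
    fun s => hasSum_altSum ha ha1 s⟩
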